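/- Let $G$ be a finite group. The subgroup graph of $G$ is the (undirected, simple) graph whose vertices are the subgroups of $G$ and in which two distinct subgroups are joined by an edge if and only if one of them is a maximal subgroup of the other; that is, $H_1$ and $H_2$ with $H_1 < H_2$ are adjacent if and only if there is no subgroup $K$ of $G$ with $H_1 < K < H_2$ (the Hasse diagram of the subgroup lattice of $G$). Then the subgroup graph of $G$ is regular (all its vertices have the same degree) if and only if $G$ is cyclic and the order $|G|$ is square-free. Moreover, if $G$ is cyclic and $|G|$ is square-free, then every vertex of the subgroup graph has degree equal to the number of distinct prime divisors of $|G|$. -/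

import Mathlib

/-- The subgroup graph of a group `G`: its vertices are the subgroups of `G`, and two subgroups are
adjacent when one of them is a maximal (proper) subgroup of the other, that is, one is strictly
contained in the other and no subgroup lies strictly between them. It is the Hasse diagram of the
subgroup lattice. -/
def subgroupGraph (G : Type*) [Group G] : SimpleGraph (Subgroup G) :=
  SimpleGraph.hasse (Subgroup G)

/-- The subgroup graph of a finite group has finitely many vertices, so its degrees are defined. -/
noncomputable instance subgroupGraphLocallyFinite (G : Type*) [Group G] [Finite G] :
    (subgroupGraph G).LocallyFinite :=
  fun _ => Fintype.ofFinite _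

theorem subgroupGraph_adj {G : Type*} [Group G] (H K : Subgroup G) :
    (subgroupGraph G).Adj H K ↔
      (H < K ∧ ¬ ∃ L : Subgroup G, H < L ∧ L < K) ∨
        (K < H ∧ ¬ ∃ L : Subgroup G, K < L ∧ L < H) := by
  simp [subgroupGraph, SimpleGraph.hasse, CovBy]

/-! Suppose the graph is regular. The vertex `⊥` has as many neighbours as there are subgroups of
prime order; call these atoms. Every other degree is compared with that number. For odd `p`, let `C`
be a maximal cyclic `p`-subgroup. It has one lower cover and contains one atom, so its upper covers
are as numerous as the atoms outside `C`. Each cover contains such an atom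
(`exists_prime_card_not_le_of_covBy`) and is its join with `C`, so covers and outside atoms
correspond bijectively. A second subgroup of order `p` would then give a cover with exactly two
subgroups of order `p`, although their number is 1 mod `p`. Once all other primes are settled, a
subgroup `P` of order `p`, in particular `p = 2`, is compared with `⊥`: the number of subgroups of
order `p` is one more than the number of overgroups of `P` of order `p ^ 2`. If `p ^ 2` divided
`|G|`, both numbers would be 1 mod `p`, which is absurd. So `|G|` is square-free and all Sylow
subgroups are normal, hence `G` is a nilpotent Z-group, that is, cyclic. Conversely, in a cyclic
group of square-free order each prime divisor of `|G|` gives exactly one edge at each vertex. -/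

theorem orderOf_eq_iff_pow_eq_one_and_ne_one {G : Type*} [Group G] {p : ℕ} (hp : p.Prime) (x : G) :
    orderOf x = p ↔ x ^ p = 1 ∧ x ≠ 1 := by
  constructor
  · intro h
    refine ⟨h ▸ pow_orderOf_eq_one x, fun h1 => ?_⟩
    rw [h1, orderOf_one] at h
    exact hp.one_lt.ne h
  · rintro ⟨h1, h2⟩
    have := Fact.mk hp
    exact orderOf_eq_prime h1 h2

/-! ### Counting subgroups of prime order. -/

/-- Frobenius' theorem for a prime, by McKay's argument. -/
theorem prime_dvd_card_pow_eq_one {G : Type*} [Group G] [Finite G] {p : ℕ} (hp : p.Prime)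
    (h : p ∣ Nat.card G) : p ∣ Nat.card {x : G // x ^ p = 1} := by
  classical
  have := Fact.mk hp
  have := Fintype.ofFinite G
  rw [Nat.card_eq_fintype_card] at h
  have hp' : p - 1 ≠ 0 := mt tsub_eq_zero_iff_le.mp (not_le_of_gt hp.one_lt)
  -- The first `p - 1` entries of a tuple with product 1 are free, so there are `|G| ^ (p - 1)`
  -- tuples.
  have hcard : p ∣ Fintype.card (Equiv.Perm.vectorsProdEqOne G p) := by
    rw [Equiv.Perm.VectorsProdEqOne.card]
    exact h.trans (dvd_pow_self _ hp')
  let f : ℕ → Equiv.Perm.vectorsProdEqOne G p → Equiv.Perm.vectorsProdEqOne G p := fun k v =>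
    Equiv.Perm.VectorsProdEqOne.rotate v k
  have hf1 : ∀ v, f 0 v = v := Equiv.Perm.VectorsProdEqOne.rotate_zero
  have hf2 : ∀ j k v, f k (f j v) = f (j + k) v := fun j k v =>
    Equiv.Perm.VectorsProdEqOne.rotate_rotate v j k
  have hf3 : ∀ v, f p v = v := Equiv.Perm.VectorsProdEqOne.rotate_length
  have hσ : ∀ k v, (f 1)^[k] v = f k v := by
    intro k
    induction k with
    | zero => intro v; exact (hf1 v).symm
    | succ k ih => intro v; rw [Function.iterate_succ_apply, ih, hf2, add_comm]
  have hσp : (f 1)^[p ^ 1] = id := by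
    funext v
    rw [pow_one, hσ, hf3, id]
  have hmod := Equiv.Perm.card_fixedPoints_modEq (f := f 1) (p := p) (n := 1) hσp
  have hdvd := (Nat.modEq_zero_iff_dvd.1 (hmod.symm.trans (Nat.modEq_zero_iff_dvd.2 hcard)))
  rw [← Nat.card_eq_fintype_card] at hdvd
  -- The tuples fixed by rotation are the constant ones.
  have e : {x : G // x ^ p = 1} ≃ Function.fixedPoints (f 1) := by
    refine Equiv.ofBijective
      (fun x => ⟨⟨List.Vector.replicate p x.1, (List.prod_replicate p x.1).trans x.2⟩,
        Subtype.ext (Subtype.ext (List.rotate_replicate x.1 p 1))⟩) ⟨?_, ?_⟩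
    · intro x y hxy
      have h1 : List.replicate p x.1 = List.replicate p y.1 :=
        congrArg (fun v => v.1.1.1) hxy
      exact Subtype.ext ((List.replicate_right_inj hp.ne_zero).1 h1)
    · rintro ⟨v, hv⟩
      obtain ⟨g, hg⟩ := List.rotate_one_eq_self_iff_eq_replicate.mp
        (Subtype.ext_iff.mp (Subtype.ext_iff.mp hv))
      rw [v.1.2] at hg
      have hgp : g ^ p = 1 := by
        rw [← List.prod_replicate, ← hg]
        exact v.2
      exact ⟨⟨g, hgp⟩, Subtype.ext (Subtype.ext (Subtype.ext hg.symm))⟩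
  rwa [Nat.card_congr e]

/-- The number of subgroups of prime order `p` is `1` modulo `p`. -/
theorem ncard_subgroups_prime_modEq_one {G : Type*} [Group G] [Finite G] {p : ℕ} (hp : p.Prime)
    (h : p ∣ Nat.card G) : {Q : Subgroup G | Nat.card Q = p}.ncard ≡ 1 [MOD p] := by
  classical
  have := Fact.mk hp
  have := Fintype.ofFinite G
  have := Fintype.ofFinite (Subgroup G)
  have h1 := prime_dvd_card_pow_eq_one hp h
  rw [Nat.card_eq_fintype_card, Fintype.card_subtype] at h1
  have h2 : (Finset.univ.filter fun x : G => x ^ p = 1) =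
      insert 1 (Finset.univ.filter fun x : G => orderOf x = p) := by
    ext x
    simp only [Finset.mem_filter, Finset.mem_univ, true_and, Finset.mem_insert,
      orderOf_eq_iff_pow_eq_one_and_ne_one hp]
    by_cases hx : x = 1 <;> simp [hx]
  rw [h2, Finset.card_insert_of_notMem (by simp [hp.one_lt.ne])] at h1
  -- Each subgroup of order `p` is generated by any of its `p - 1` nontrivial elements.
  have h3 : (Finset.univ.filter fun x : G => orderOf x = p).card =
      (Finset.univ.filter fun Q : Subgroup G => Nat.card Q = p).card * (p - 1) := by
    rw [Finset.card_eq_sum_card_fiberwise (f := Subgroup.zpowers)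
      (t := Finset.univ.filter fun Q : Subgroup G => Nat.card Q = p), Finset.sum_const_nat]
    · intro Q hQ
      simp only [Finset.mem_filter, Finset.mem_univ, true_and] at hQ
      have : (Finset.filter (fun x => Subgroup.zpowers x = Q)
          (Finset.univ.filter fun x : G => orderOf x = p)) =
          (Finset.univ.filter fun x : G => x ∈ Q).erase 1 := by
        ext x
        simp only [Finset.mem_filter, Finset.mem_univ, true_and, Finset.mem_erase]
        constructor
        · rintro ⟨hx, rfl⟩
          exact ⟨((orderOf_eq_iff_pow_eq_one_and_ne_one hp x).1 hx).2,
            Subgroup.mem_zpowers x⟩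
        · rintro ⟨hx, hxQ⟩
          have hle : Subgroup.zpowers x ≤ Q := (Subgroup.zpowers_le).2 hxQ
          have hox : orderOf x = p := by
            have := Subgroup.card_dvd_of_le hle
            rw [Nat.card_zpowers, hQ, Nat.dvd_prime hp] at this
            exact this.resolve_left (by rwa [orderOf_eq_one_iff])
          exact ⟨hox, Subgroup.eq_of_le_of_card_ge hle
            (by rw [Nat.card_zpowers, hox, hQ])⟩
      rw [this, Finset.card_erase_of_mem (by simp), ← hQ, ← Fintype.card_subtype,
        ← Nat.card_eq_fintype_card]
    · intro x hx
      simpa only [Finset.coe_filter, Finset.mem_univ, true_and, Set.mem_ofPred_eq,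
        Nat.card_zpowers] using hx
  rw [h3] at h1
  have h4 : {Q : Subgroup G | Nat.card Q = p}.ncard =
      (Finset.univ.filter fun Q : Subgroup G => Nat.card Q = p).card := by
    rw [← Set.ncard_coe_finset]; simp
  rw [h4]
  set t := (Finset.univ.filter fun Q : Subgroup G => Nat.card Q = p).card
  obtain ⟨q, rfl⟩ : ∃ q, p = q + 1 := ⟨p - 1, by have := hp.pos; omega⟩
  rw [Nat.add_sub_cancel] at h1
  have h5 : t * q + 1 + t ≡ 0 + t [MOD (q + 1)] :=
    Nat.ModEq.add_right _ (Nat.modEq_zero_iff_dvd.2 h1)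
  have h6 : t * q + 1 + t = 1 + (q + 1) * t := by ring
  rw [h6, zero_add] at h5
  exact (h5.symm.trans (by simp [Nat.ModEq]))

/-! ### Degrees and covers in the subgroup lattice. -/

theorem subgroupGraph_degree_eq {G : Type*} [Group G] [Finite G] (H : Subgroup G) :
    (subgroupGraph G).degree H = {K | H ⋖ K}.ncard + {K | K ⋖ H}.ncard := by
  have hdisj : Disjoint {K : Subgroup G | H ⋖ K} {K | K ⋖ H} :=
    Set.disjoint_left.2 fun K h1 h2 => lt_asymm h1.lt h2.lt
  rw [← Set.ncard_union_eq hdisj, ← SimpleGraph.card_neighborSet_eq_degree,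
    ← Nat.card_eq_fintype_card]
  rfl

theorem Subgroup.covBy_of_card_eq_prime_mul {G : Type*} [Group G] [Finite G] {H K : Subgroup G}
    {q : ℕ} (hq : q.Prime) (hle : H ≤ K) (h : Nat.card K = q * Nat.card H) : H ⋖ K := by
  have hpos : 0 < Nat.card H := Nat.card_pos
  refine ⟨lt_of_le_of_ne hle ?_, fun L h1 h2 => ?_⟩
  · rintro rfl
    have := hq.one_lt
    nlinarith
  · obtain ⟨a, ha⟩ := Subgroup.card_dvd_of_le h1.le
    obtain ⟨b, hb⟩ := Subgroup.card_dvd_of_le h2.le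
    have hab : a * b = q := by
      rw [hb, ha, mul_comm q, mul_assoc] at h
      exact Nat.eq_of_mul_eq_mul_left hpos h
    rcases (Nat.dvd_prime hq).1 (Dvd.intro b hab) with rfl | rfl
    · exact h1.not_ge (Subgroup.eq_of_le_of_card_ge h1.le (by simp [ha])).ge
    · have hb1 : b = 1 := by
        have := hq.pos
        nlinarith
      exact h2.not_ge (Subgroup.eq_of_le_of_card_ge h2.le (by simp [hb, hb1])).ge

theorem Subgroup.bot_covBy_iff {G : Type*} [Group G] [Finite G] {Q : Subgroup G} :
    ⊥ ⋖ Q ↔ (Nat.card Q).Prime := by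
  constructor
  · intro h
    have hne : Nat.card Q ≠ 1 := fun h1 => h.lt.ne' (Subgroup.card_eq_one.1 h1)
    obtain ⟨p, hp, hpd⟩ := Nat.exists_prime_and_dvd hne
    have := Fact.mk hp
    obtain ⟨x, hx⟩ := exists_prime_orderOf_dvd_card' p hpd
    have hle : Subgroup.zpowers (x : G) ≤ Q := Subgroup.zpowers_le.2 x.2
    have hcard : Nat.card (Subgroup.zpowers (x : G)) = p := by
      rw [Nat.card_zpowers, Subgroup.orderOf_coe, hx]
    have hbot : ⊥ < Subgroup.zpowers (x : G) := by
      rw [bot_lt_iff_ne_bot, ne_eq, ← Subgroup.card_eq_one, hcard]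
      exact hp.one_lt.ne'
    rcases hle.lt_or_eq with h1 | h1
    · exact (h.2 hbot h1).elim
    · rwa [← h1, hcard]
  · intro h
    exact Subgroup.covBy_of_card_eq_prime_mul h bot_le (by simp)

/-- A subgroup covered in a `p`-group has index `p`. -/
theorem IsPGroup.card_eq_of_covBy {G : Type*} [Group G] [Finite G] {p : ℕ} (hp : p.Prime)
    {H K : Subgroup G} (hK : IsPGroup p K) (h : H ⋖ K) : Nat.card K = p * Nat.card H := by
  have := Fact.mk hp
  obtain ⟨m, hm⟩ := IsPGroup.iff_card.1 hK
  obtain ⟨n, hn⟩ := IsPGroup.iff_card.1 (hK.to_le h.le)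
  have hlt : n < m := by
    have : Nat.card H < Nat.card K := by
      refine lt_of_le_of_ne (Subgroup.card_le_of_le h.le) fun h1 => h.lt.ne ?_
      exact Subgroup.eq_of_le_of_card_ge h.le h1.ge
    rw [hm, hn] at this
    exact (Nat.pow_lt_pow_iff_right hp.one_lt).1 this
  -- Sylow puts a subgroup of order `p ^ (n + 1)` between `H` and `K`; covering forces it to be `K`.
  obtain ⟨L, hL, hHL⟩ := Sylow.exists_subgroup_card_pow_succ (p := p) (n := n) (G := K)
    (hm ▸ pow_dvd_pow p hlt) (H := H.subgroupOf K)
    (by rw [Nat.card_congr (Subgroup.subgroupOfEquivOfLe h.le).toEquiv, hn])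
  have hcard : Nat.card (L.map K.subtype) = p ^ (n + 1) := by
    rw [← hL]
    exact Subgroup.card_map_of_injective K.subtype_injective
  have hle : H ≤ L.map K.subtype := by
    have := Subgroup.map_mono (f := K.subtype) hHL
    rwa [Subgroup.map_subgroupOf_eq_of_le h.le] at this
  have hHlt : H < L.map K.subtype := by
    refine lt_of_le_of_ne hle fun h1 => ?_
    rw [← h1, hn] at hcard
    exact absurd (Nat.pow_right_injective hp.two_le hcard) (by omega)
  have hLK : L.map K.subtype = K := by
    by_contra hne
    exact h.2 hHlt (lt_of_le_of_ne (Subgroup.map_subtype_le L) hne)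
  rw [hLK] at hcard
  rw [hcard, hn, pow_succ']

/-! ### Overgroups of order `p ^ 2`. -/

/-- The number of subgroups of order `p ^ 2` above a subgroup of order `p` is `1` modulo `p`. -/
theorem ncard_prime_sq_overgroups_modEq_one {G : Type*} [Group G] [Finite G] {p : ℕ}
    (hp : p.Prime) (h : p ^ 2 ∣ Nat.card G) {P : Subgroup G} (hP : Nat.card P = p) :
    {K : Subgroup G | P ≤ K ∧ Nat.card K = p ^ 2}.ncard ≡ 1 [MOD p] := by
  have := Fact.mk hp
  set N := Subgroup.normalizer (P : Set G) with hN
  set P' := P.subgroupOf N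
  have hPN : P ≤ N := Subgroup.le_normalizer
  have hP' : Nat.card P' = p := by
    rw [Nat.card_congr (Subgroup.subgroupOfEquivOfLe hPN).toEquiv, hP]
  have hdvd : p ∣ Nat.card (N ⧸ P') :=
    Sylow.prime_dvd_card_quotient_normalizer (n := 1) (by simpa using h) (by simpa using hP)
  have hcomap : ∀ Q : Subgroup (N ⧸ P'),
      Nat.card (Q.comap (QuotientGroup.mk' P')) = p * Nat.card Q := by
    intro Q
    have h1 := (Q.comap (QuotientGroup.mk' P')).card_mul_index
    rw [Subgroup.index_comap_of_surjective _ (QuotientGroup.mk'_surjective P')] at h1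
    have h2 := Q.card_mul_index
    have h3 := Subgroup.card_eq_card_quotient_mul_card_subgroup P'
    have h4 : Q.index ≠ 0 := Subgroup.index_ne_zero_of_finite
    rw [hP', ← h2, ← h1] at h3
    apply Nat.eq_of_mul_eq_mul_right (Nat.pos_of_ne_zero h4)
    rw [h3]; ring
  -- By the correspondence theorem, the count reduces to subgroups of order `p` in `N / P`.
  let F : Subgroup (N ⧸ P') → Subgroup G := fun Q =>
    (Q.comap (QuotientGroup.mk' P')).map N.subtype
  have hF : Function.Injective F :=
    (Subgroup.map_injective N.subtype_injective).comp
      (Subgroup.comap_injective (QuotientGroup.mk'_surjective P'))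
  have hFcard : ∀ Q, Nat.card (F Q) = p * Nat.card Q := fun Q => by
    rw [← hcomap Q]
    exact Subgroup.card_map_of_injective N.subtype_injective
  have himage : {K : Subgroup G | P ≤ K ∧ Nat.card K = p ^ 2} =
      F '' {Q | Nat.card Q = p} := by
    ext K
    simp only [Set.mem_ofPred_eq, Set.mem_image]
    constructor
    · rintro ⟨hPK, hK⟩
      -- A group of order `p ^ 2` is abelian, so `K` normalizes `P`.
      have hcomm := (IsPGroup.isMulCommutative_of_card_eq_prime_sq hK).is_comm.comm
      have hKN : K ≤ N := by
        intro x hx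
        rw [hN, Subgroup.mem_normalizer_iff]
        intro y
        constructor
        · intro hy
          have := congrArg Subtype.val (hcomm ⟨x, hx⟩ ⟨y, hPK hy⟩)
          simp only [Subgroup.coe_mul] at this
          rwa [this, mul_inv_cancel_right]
        · intro hy
          have := congrArg Subtype.val (hcomm ⟨x, hx⟩ ⟨_, hPK hy⟩)
          simp only [Subgroup.coe_mul, inv_mul_cancel_right] at this
          rwa [mul_left_cancel this] at hy
      have hFK : F ((K.subgroupOf N).map (QuotientGroup.mk' P')) = K := by
        simp only [F]
        rw [Subgroup.comap_map_eq_self, Subgroup.map_subgroupOf_eq_of_le hKN]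
        rw [QuotientGroup.ker_mk']
        exact Subgroup.comap_mono hPK
      refine ⟨_, ?_, hFK⟩
      have := hFcard ((K.subgroupOf N).map (QuotientGroup.mk' P'))
      rw [hFK, hK, pow_two] at this
      exact (Nat.eq_of_mul_eq_mul_left hp.pos this).symm
    · rintro ⟨Q, hQ, rfl⟩
      refine ⟨?_, by rw [hFcard, hQ, pow_two]⟩
      have h1 : P' ≤ Q.comap (QuotientGroup.mk' P') := by
        have := Subgroup.comap_mono (f := QuotientGroup.mk' P') (bot_le : ⊥ ≤ Q)
        rwa [MonoidHom.comap_bot, QuotientGroup.ker_mk'] at this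
      have h2 := Subgroup.map_mono (f := N.subtype) h1
      rwa [Subgroup.map_subgroupOf_eq_of_le hPN] at h2
  rw [himage, Set.ncard_image_of_injective _ hF]
  exact ncard_subgroups_prime_modEq_one hp hdvd

/-! ### Noncyclic `p`-groups with a cyclic subgroup of index `p`, for odd `p`. -/

/-- Oddness is essential: for `p = 2` and `u = -1` the sum vanishes, as happens in quaternion
groups. -/
theorem Int.exists_geom_sum_eq_odd_mul {p : ℕ} (hodd : Odd p) {u : ℤ}
    (hu : (p : ℤ) ∣ u - 1) :
    ∃ s : ℤ, ∑ i ∈ Finset.range p, u ^ i = p * s ∧ (p : ℤ) ∣ s - 1 := by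
  obtain ⟨v, hv⟩ := hu
  obtain ⟨w, hw⟩ := odd_sq_dvd_geom_sum₂_sub (R := ℤ) (p := p) 1 v hodd
  have hu' : u = 1 + p * v := by linarith
  simp only [one_pow, mul_one, ← hu'] at hw
  refine ⟨1 + p * w, by linear_combination hw, ⟨w, by ring⟩⟩

theorem mul_zpow_conj_pow {G : Type*} [Group G] {c y : G} {u : ℤ} (h : y * c * y⁻¹ = c ^ u)
    (i : ℤ) (n : ℕ) :
    (c ^ i * y) ^ n = c ^ (i * ∑ k ∈ Finset.range n, u ^ k) * y ^ n := by
  have hconj : ∀ m : ℤ, y * c ^ m = c ^ (u * m) * y := fun m => by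
    rw [zpow_mul, ← h, conj_zpow, inv_mul_cancel_right]
  induction n with
  | zero => simp
  | succ n ih =>
    rw [pow_succ', ih, mul_assoc, ← mul_assoc y, hconj, mul_assoc (c ^ _) y, ← pow_succ',
      ← mul_assoc, ← zpow_add]
    congr 2
    rw [Finset.sum_range_succ', ← Finset.sum_congr rfl fun k _ => (pow_succ' u k).symm,
      ← Finset.mul_sum]
    ring

/-- With `C = ⟨c⟩`, `y ∉ C` and `y ^ p = c ^ j`, some `c ^ i * y` has trivial `p`-th power. This is
a linear congruence for `i`, solvable because `p ∣ j` and the geometric sum is `p` times a unit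
modulo the order of `c`. -/
theorem IsPGroup.exists_pow_eq_one_notMem_of_isCyclic {G : Type*} [Group G] [Finite G] {p : ℕ}
    (hp : p.Prime) (hodd : Odd p) (hG : IsPGroup p G) (hcyc : ¬ IsCyclic G) {C : Subgroup G}
    [hCn : C.Normal] [hC : IsCyclic C] (hindex : C.index = p) : ∃ x, x ∉ C ∧ x ^ p = 1 := by
  have := Fact.mk hp
  obtain ⟨c, rfl⟩ := (Subgroup.isCyclic_iff_exists_zpowers_eq_top C).1 hC
  obtain ⟨y, hy⟩ : ∃ y, y ∉ Subgroup.zpowers c := by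
    by_contra! h
    rw [(Subgroup.eq_top_iff' _).2 h, Subgroup.index_top] at hindex
    exact hp.one_lt.ne hindex
  obtain ⟨k, hk⟩ := IsPGroup.iff_orderOf.1 hG c
  have hk0 : k ≠ 0 := by
    rintro rfl
    have h1 := (Subgroup.zpowers c).card_mul_index
    rw [Nat.card_zpowers, hk, pow_zero, one_mul, hindex] at h1
    exact hcyc (isCyclic_of_prime_card h1.symm)
  have hpn : (p : ℤ) ∣ orderOf c := by
    rw [hk]; exact_mod_cast dvd_pow_self p hk0
  have hcop : ∀ a : ℤ, ¬ (p : ℤ) ∣ a → IsCoprime a (orderOf c : ℤ) := fun a ha => by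
    rw [hk, Nat.cast_pow]
    exact (((Nat.prime_iff_prime_int.1 hp).coprime_iff_not_dvd.2 ha).symm).pow_right
  obtain ⟨u, hu⟩ := Subgroup.mem_zpowers_iff.1 (hCn.conj_mem c (Subgroup.mem_zpowers c) y)
  obtain ⟨j, hj⟩ := Subgroup.mem_zpowers_iff.1
    (hindex ▸ Subgroup.pow_index_mem (Subgroup.zpowers c) y)
  -- Since `y ^ p` lies in `C`, it commutes with `c`; hence `u ^ p` is 1 mod `p`, and Fermat gives
  -- the claim.
  have hu1 : (p : ℤ) ∣ u - 1 := by
    have h1 : ∀ n : ℕ, y ^ n * c * (y ^ n)⁻¹ = c ^ (u ^ n) := by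
      intro n
      induction n with
      | zero => simp
      | succ n ih =>
        have : y ^ (n + 1) * c * (y ^ (n + 1))⁻¹ = y * (y ^ n * c * (y ^ n)⁻¹) * y⁻¹ := by
          rw [pow_succ']; group
        rw [this, ih, ← conj_zpow, ← hu, ← zpow_mul, pow_succ']
    have h2 := h1 p
    rw [← hj, ← zpow_add_one, ← zpow_neg, ← zpow_add, add_assoc, add_comm 1, ← add_assoc,
      add_neg_cancel, zero_add, zpow_eq_zpow_iff_modEq] at h2
    have h3 : (u ^ p) ≡ 1 [ZMOD p] := (h2.of_dvd hpn).symm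
    rw [← ZMod.intCast_eq_intCast_iff, Int.cast_pow, ZMod.pow_card,
      ZMod.intCast_eq_intCast_iff] at h3
    exact h3.symm.dvd
  -- Otherwise `y ^ p` generates `C`, and then `y` generates `G`.
  have hpj : (p : ℤ) ∣ j := by
    by_contra hpj
    obtain ⟨a, b, hab⟩ := hcop j hpj
    apply hcyc
    have hle : Subgroup.zpowers c ≤ Subgroup.zpowers y := by
      rw [Subgroup.zpowers_le, Subgroup.mem_zpowers_iff]
      refine ⟨p * a, ?_⟩
      rw [zpow_mul, zpow_natCast, ← hj, ← zpow_mul]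
      nth_rw 2 [← zpow_one c]
      rw [← hab, zpow_add, mul_comm b, zpow_mul c (orderOf c), zpow_natCast, pow_orderOf_eq_one,
        one_zpow, mul_one, mul_comm]
    have h1 := Subgroup.index_dvd_of_le hle
    rw [hindex, Nat.dvd_prime hp] at h1
    refine isCyclic_iff_exists_zpowers_eq_top.2 ⟨y, ?_⟩
    rcases h1 with h1 | h1
    · exact Subgroup.index_eq_one.1 h1
    · refine (hy ?_).elim
      have h2 : Subgroup.zpowers c = Subgroup.zpowers y := by
        refine Subgroup.eq_of_le_of_card_ge hle (le_of_eq ?_)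
        have h3 := (Subgroup.zpowers c).card_mul_index
        rw [← (Subgroup.zpowers y).card_mul_index, hindex, h1] at h3
        exact (Nat.eq_of_mul_eq_mul_right hp.pos h3).symm
      exact h2 ▸ Subgroup.mem_zpowers y
  obtain ⟨j', rfl⟩ := hpj
  obtain ⟨s, hs, hs1⟩ := Int.exists_geom_sum_eq_odd_mul hodd hu1
  have hps : ¬ (p : ℤ) ∣ s := fun h => by
    have h1 := dvd_sub h hs1
    rw [sub_sub_cancel] at h1
    exact hp.one_lt.ne' (by exact_mod_cast Int.eq_one_of_dvd_one (by positivity) h1)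
  obtain ⟨a, b, hab⟩ := hcop s hps
  -- Here `a` inverts `s` modulo the order of `c`, so this exponent `i` solves `i * p * s + p * j' ≡
  -- 0`.
  refine ⟨c ^ (-(a * j')) * y, ?_, ?_⟩
  · rwa [Subgroup.mul_mem_cancel_left _ (zpow_mem (Subgroup.mem_zpowers c) _)]
  · rw [mul_zpow_conj_pow hu.symm, hs, ← hj, ← zpow_add]
    have : -(a * j') * (p * s) + p * j' = orderOf c * (b * p * j') := by
      linear_combination (-(p : ℤ) * j') * hab
    rw [this, zpow_mul, zpow_natCast, pow_orderOf_eq_one, one_zpow]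

/-! ### Subgroups of cyclic groups, and atoms below a subgroup. -/

/-- A subgroup of order `n` exhausts the solutions of `x ^ n = 1`, of which a cyclic group has at
most `n`. -/
theorem Subgroup.eq_of_card_eq_of_isCyclic {G : Type*} [Group G] [Finite G] [IsCyclic G]
    {H K : Subgroup G} (h : Nat.card H = Nat.card K) : H = K := by
  classical
  have := Fintype.ofFinite G
  have key : ∀ L : Subgroup G, Nat.card L = Nat.card H →
      (L : Set G) = (Finset.univ.filter fun x : G => x ^ Nat.card H = 1 : Finset G) := by
    intro L hL
    refine Set.eq_of_subset_of_ncard_le ?_ ?_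
    · intro x hx
      have : x ^ Nat.card L = 1 := by
        have := pow_card_eq_one' (x := (⟨x, hx⟩ : L))
        exact congrArg Subtype.val this
      rw [Finset.coe_filter]
      exact ⟨Finset.mem_univ _, hL ▸ this⟩
    · rw [Set.ncard_coe_finset]
      exact (IsCyclic.card_pow_eq_one_le Nat.card_pos).trans hL.ge
  exact SetLike.coe_injective ((key H rfl).trans (key K h.symm).symm)

theorem Subgroup.eq_of_card_eq_of_le_isCyclic {G : Type*} [Group G] [Finite G] {C : Subgroup G}
    [IsCyclic C] {H K : Subgroup G} (hH : H ≤ C) (hK : K ≤ C) (h : Nat.card H = Nat.card K) :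
    H = K := by
  have h1 : H.subgroupOf C = K.subgroupOf C := by
    apply Subgroup.eq_of_card_eq_of_isCyclic
    rw [Nat.card_congr (Subgroup.subgroupOfEquivOfLe hH).toEquiv,
      Nat.card_congr (Subgroup.subgroupOfEquivOfLe hK).toEquiv, h]
  rw [← Subgroup.map_subgroupOf_eq_of_le hH, h1, Subgroup.map_subgroupOf_eq_of_le hK]

theorem CovBy.sup_eq_of_not_le {α : Type*} [SemilatticeSup α] {a b c : α} (h : a ⋖ b)
    (hc : c ≤ b) (hca : ¬ c ≤ a) : a ⊔ c = b :=
  (h.eq_or_eq le_sup_left (sup_le h.le hc)).resolve_left fun h1 => hca (h1 ▸ le_sup_right)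

/-- Cauchy's theorem for a subgroup. -/
theorem Subgroup.exists_le_card_eq_prime {G : Type*} [Group G] [Finite G] {K : Subgroup G} {p : ℕ}
    (hp : p.Prime) (h : p ∣ Nat.card K) : ∃ Q ≤ K, Nat.card Q = p := by
  have := Fact.mk hp
  obtain ⟨x, hx⟩ := exists_prime_orderOf_dvd_card' p h
  refine ⟨Subgroup.zpowers (x : G), Subgroup.zpowers_le.2 x.2, ?_⟩
  rw [Nat.card_zpowers, Subgroup.orderOf_coe, hx]

theorem ncard_subgroups_prime_le_modEq_one {G : Type*} [Group G] [Finite G] {p : ℕ} (hp : p.Prime)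
    {K : Subgroup G} (h : p ∣ Nat.card K) :
    {Q : Subgroup G | Q ≤ K ∧ Nat.card Q = p}.ncard ≡ 1 [MOD p] := by
  have himage : {Q : Subgroup G | Q ≤ K ∧ Nat.card Q = p} =
      (fun L : Subgroup K => L.map K.subtype) '' {L | Nat.card L = p} := by
    ext Q
    simp only [Set.mem_ofPred_eq, Set.mem_image]
    constructor
    · rintro ⟨hQK, hQ⟩
      refine ⟨Q.subgroupOf K, ?_, Subgroup.map_subgroupOf_eq_of_le hQK⟩
      rw [Nat.card_congr (Subgroup.subgroupOfEquivOfLe hQK).toEquiv, hQ]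
    · rintro ⟨L, hL, rfl⟩
      exact ⟨Subgroup.map_subtype_le L,
        (Subgroup.card_map_of_injective K.subtype_injective).trans hL⟩
  rw [himage, Set.ncard_image_of_injective _ (Subgroup.map_injective K.subtype_injective)]
  exact ncard_subgroups_prime_modEq_one hp h

theorem ncard_covBy_isCyclic_isPGroup {G : Type*} [Group G] [Finite G] {p : ℕ} (hp : p.Prime)
    {C : Subgroup G} [IsCyclic C] (hC : IsPGroup p C) (hne : C ≠ ⊥) :
    {K | K ⋖ C}.ncard = 1 := by
  have hex : ∃ K, K ⋖ C := by
    obtain ⟨K, _, hK⟩ := exists_le_covBy_of_lt (bot_lt_iff_ne_bot.2 hne)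
    exact ⟨K, hK⟩
  obtain ⟨K, hK⟩ := hex
  rw [Set.ncard_eq_one]
  refine ⟨K, Set.eq_singleton_iff_unique_mem.2 ⟨hK, fun L hL => ?_⟩⟩
  refine Subgroup.eq_of_card_eq_of_le_isCyclic hL.le hK.le ?_
  have h1 := hC.card_eq_of_covBy hp hL
  rw [hC.card_eq_of_covBy hp hK] at h1
  exact (Nat.eq_of_mul_eq_mul_left hp.pos h1).symm

/-! ### Uniqueness for odd prime orders. -/

/-- For odd `p`, a cover of a maximal cyclic `p`-subgroup contains a subgroup of prime order outside
it. -/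
theorem exists_prime_card_not_le_of_covBy {G : Type*} [Group G] [Finite G] {p : ℕ} (hp : p.Prime)
    (hodd : Odd p) {C K : Subgroup G}
    (hC : Maximal (fun C : Subgroup G => IsCyclic C ∧ IsPGroup p C) C) (hK : C ⋖ K) :
    ∃ Q ≤ K, (Nat.card Q).Prime ∧ ¬ Q ≤ C := by
  have := Fact.mk hp
  have hCcyc := hC.prop.1
  by_contra! hall
  -- All atoms of `K` now lie in the `p`-group `C`, so by Cauchy no other prime divides `|K|`.
  have hKp : IsPGroup p K := by
    obtain ⟨m, hm⟩ := IsPGroup.iff_card.1 hC.prop.2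
    refine IsPGroup.of_card (n := (Nat.card K).primeFactorsList.length)
      (Nat.eq_prime_pow_of_unique_prime_dvd Nat.card_pos.ne' fun {q} hq hqd => ?_)
    obtain ⟨Q, hQK, hQ⟩ := Subgroup.exists_le_card_eq_prime hq hqd
    have h1 := Subgroup.card_dvd_of_le (hall Q hQK (hQ ▸ hq))
    rw [hQ, hm] at h1
    exact (Nat.prime_dvd_prime_iff_eq hq hp).1 (hq.dvd_of_dvd_pow h1)
  have hKcyc : ¬ IsCyclic K := fun h =>
    hK.lt.not_ge (hC.le_of_ge ⟨h, hKp⟩ hK.le)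
  have hcard := hKp.card_eq_of_covBy hp hK
  have hindex : (C.subgroupOf K).index = p := by
    have h1 := (C.subgroupOf K).card_mul_index
    rw [Nat.card_congr (Subgroup.subgroupOfEquivOfLe hK.le).toEquiv, hcard, mul_comm p] at h1
    exact Nat.eq_of_mul_eq_mul_left Nat.card_pos h1
  have hnormal : (C.subgroupOf K).Normal := by
    apply Subgroup.normal_of_index_eq_minFac_card
    obtain ⟨m, hm⟩ := IsPGroup.iff_card.1 hKp
    have hm0 : m ≠ 0 := by
      rintro rfl
      rw [hm, pow_zero] at hcard
      exact hp.one_lt.ne' (Nat.eq_one_of_mul_eq_one_right hcard.symm)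
    rw [hindex, hm, hp.pow_minFac hm0]
  have hcyc : IsCyclic (C.subgroupOf K) :=
    (Subgroup.subgroupOfEquivOfLe hK.le).isCyclic.2 hCcyc
  obtain ⟨x, hxC, hx⟩ := hKp.exists_pow_eq_one_notMem_of_isCyclic hp hodd hKcyc hindex
  have hord : orderOf x = p := by
    refine (orderOf_eq_iff_pow_eq_one_and_ne_one hp x).2 ⟨hx, ?_⟩
    rintro rfl
    exact hxC (one_mem _)
  refine hxC (Subgroup.mem_subgroupOf.2
    (hall (Subgroup.zpowers (x : G)) (Subgroup.zpowers_le.2 x.2) ?_ (Subgroup.mem_zpowers _)))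
  rw [Nat.card_zpowers, Subgroup.orderOf_coe, hord]
  exact hp

theorem degree_bot_eq {G : Type*} [Group G] [Finite G] :
    (subgroupGraph G).degree ⊥ = {Q : Subgroup G | (Nat.card Q).Prime}.ncard := by
  rw [subgroupGraph_degree_eq]
  have h1 : {K : Subgroup G | K ⋖ ⊥} = ∅ := by
    ext K
    simp
  have h2 : {K : Subgroup G | ⊥ ⋖ K} = {Q : Subgroup G | (Nat.card Q).Prime} := by
    ext K
    exact Subgroup.bot_covBy_iff
  rw [h1, h2, Set.ncard_empty, add_zero]

/-- In a group with regular subgroup graph, subgroups of a given odd prime order are unique. -/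
theorem subgroup_eq_of_card_eq_odd_prime {G : Type*} [Group G] [Finite G] {d : ℕ}
    (hreg : (subgroupGraph G).IsRegularOfDegree d) {p : ℕ} (hp : p.Prime) (hodd : Odd p)
    {P Q : Subgroup G} (hP : Nat.card P = p) (hQ : Nat.card Q = p) : P = Q := by
  have := Fact.mk hp
  by_contra hPQ
  obtain ⟨C, hPC, hC⟩ := (Set.toFinite {C : Subgroup G | IsCyclic C ∧ IsPGroup p C}).exists_le_maximal
    (a := P) ⟨isCyclic_of_prime_card hP, IsPGroup.of_card (n := 1) (by rw [hP, pow_one])⟩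
  have hCcyc := hC.prop.1
  have hCp : IsPGroup p C := hC.prop.2
  have hCne : C ≠ ⊥ := by
    rintro rfl
    rw [le_bot_iff.1 hPC, Subgroup.card_bot] at hP
    exact hp.one_lt.ne hP
  set A : Set (Subgroup G) := {Q | (Nat.card Q).Prime ∧ ¬ Q ≤ C} with hA
  have hatoms : {Q : Subgroup G | (Nat.card Q).Prime} = insert P A := by
    ext R
    simp only [hA, Set.mem_ofPred_eq, Set.mem_insert_iff]
    constructor
    · intro hR
      by_cases hRC : R ≤ C
      · left
        refine Subgroup.eq_of_card_eq_of_le_isCyclic hRC hPC ?_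
        obtain ⟨m, hm⟩ := IsPGroup.iff_card.1 hCp
        have h1 := Subgroup.card_dvd_of_le hRC
        rw [hm] at h1
        rw [hP]
        exact (Nat.prime_dvd_prime_iff_eq hR hp).1 (hR.dvd_of_dvd_pow h1)
      · exact Or.inr ⟨hR, hRC⟩
    · rintro (rfl | h)
      · rwa [hP]
      · exact h.1
  -- In `deg ⊥ = deg C`, the atom `P` cancels the single lower cover of `C`.
  have hncard : {K | C ⋖ K}.ncard = A.ncard := by
    have h1 := (hreg ⊥).trans (hreg C).symm
    rw [degree_bot_eq, subgroupGraph_degree_eq, ncard_covBy_isCyclic_isPGroup hp hCp hCne, hatoms,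
      Set.ncard_insert_of_notMem (fun h => h.2 hPC)] at h1
    exact (Nat.add_right_cancel h1).symm
  choose! f hfK hfprime hfC using fun K (hK : C ⋖ K) =>
    exists_prime_card_not_le_of_covBy hp hodd hC hK
  have hsup : ∀ K, C ⋖ K → C ⊔ f K = K := fun K hK => hK.sup_eq_of_not_le (hfK K hK) (hfC K hK)
  have hinj : Set.InjOn f {K | C ⋖ K} := fun K hK L hL h => by
    rw [← hsup K hK, h, hsup L hL]
  have himage : f '' {K | C ⋖ K} = A := by
    refine Set.eq_of_subset_of_ncard_le ?_ ?_
    · rintro _ ⟨K, hK, rfl⟩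
      exact ⟨hfprime K hK, hfC K hK⟩
    · rw [hinj.ncard_image, hncard]
  have hnotle : ∀ R : Subgroup G, Nat.card R = p → R ≠ P → R ∈ A := fun R hR hRP =>
    ⟨hR ▸ hp, fun hRC => hRP (Subgroup.eq_of_card_eq_of_le_isCyclic hRC hPC (hR.trans hP.symm))⟩
  obtain ⟨K, hK, hKQ⟩ := himage.symm ▸ hnotle Q hQ (Ne.symm hPQ)
  -- An outside atom `R ≤ K` is `f L` for some cover `L`, and `L = C ⊔ R = K`, so `R = f K = Q`.
  have hpair : {R : Subgroup G | R ≤ K ∧ Nat.card R = p} = {P, Q} := by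
    ext R
    simp only [Set.mem_ofPred_eq, Set.mem_insert_iff, Set.mem_singleton_iff]
    constructor
    · rintro ⟨hRK, hR⟩
      by_cases hRP : R = P
      · exact Or.inl hRP
      · right
        have hRA := hnotle R hR hRP
        obtain ⟨L, hL, hLR⟩ := himage.symm ▸ hRA
        have hLK : L = K := by
          rw [← hsup L hL, hLR]
          exact CovBy.sup_eq_of_not_le hK hRK hRA.2
        rw [← hKQ, ← hLR, hLK]
    · rintro (rfl | rfl)
      · exact ⟨hPC.trans (CovBy.le hK), hP⟩
      · exact ⟨hKQ ▸ hfK K hK, hQ⟩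
  have hmod := ncard_subgroups_prime_le_modEq_one hp (K := K)
    (hP ▸ Subgroup.card_dvd_of_le (hPC.trans (CovBy.le hK)))
  rw [hpair, Set.ncard_pair hPQ] at hmod
  have := (Nat.modEq_iff_dvd' (by norm_num : 1 ≤ 2)).1 hmod.symm
  exact hp.one_lt.ne' (Nat.dvd_one.1 this)

/-! ### The last remaining prime. -/

theorem Subgroup.normal_of_forall_card_eq {G : Type*} [Group G] [Finite G] {Q : Subgroup G}
    (h : ∀ R : Subgroup G, Nat.card R = Nat.card Q → R = Q) : Q.Normal := by
  refine ⟨fun x hx g => ?_⟩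
  have h1 : Q.map (MulAut.conj g).toMonoidHom = Q :=
    h _ (Subgroup.card_map_of_injective (MulAut.conj g).injective)
  rw [← h1]
  exact ⟨x, hx, rfl⟩

theorem Subgroup.card_sup_eq_mul_of_coprime {G : Type*} [Group G] [Finite G] {P Q : Subgroup G}
    [Q.Normal] (h : (Nat.card P).Coprime (Nat.card Q)) :
    Nat.card (P ⊔ Q : Subgroup G) = Nat.card Q * Nat.card P := by
  have h1 := Subgroup.relIndex_mul_relIndex ⊥ Q (P ⊔ Q) bot_le le_sup_right
  rw [Subgroup.relIndex_sup_right, Subgroup.relIndex_bot_left, Subgroup.relIndex_bot_left,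
    ← Subgroup.inf_relIndex_right, inf_comm, (Subgroup.disjoint_of_coprime_natCard h).eq_bot,
    Subgroup.relIndex_bot_left] at h1
  exact h1.symm

/-- In a group with regular subgroup graph, if the subgroups of prime order other than `p` are
unique, then so are those of order `p`, and `p ^ 2` does not divide the order of the group. -/
theorem prime_sq_not_dvd_card_and_ncard_eq_one {G : Type*} [Group G] [Finite G] {d : ℕ}
    (hreg : (subgroupGraph G).IsRegularOfDegree d) {p : ℕ} (hp : p.Prime) (hdvd : p ∣ Nat.card G)
    (huniq : ∀ Q R : Subgroup G, (Nat.card Q).Prime → Nat.card Q ≠ p → Nat.card Q = Nat.card R →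
      Q = R) :
    ¬ p ^ 2 ∣ Nat.card G ∧ {Q : Subgroup G | Nat.card Q = p}.ncard = 1 := by
  have := Fact.mk hp
  obtain ⟨P, -, hP⟩ := Subgroup.exists_le_card_eq_prime (K := (⊤ : Subgroup G)) hp (by simpa)
  have hPcyc : IsCyclic P := isCyclic_of_prime_card hP
  have hPp : IsPGroup p P := IsPGroup.of_card (n := 1) (by rw [hP, pow_one])
  have hPne : P ≠ ⊥ := by
    rintro rfl
    rw [Subgroup.card_bot] at hP
    exact hp.one_lt.ne hP
  set B : Set (Subgroup G) := {Q | (Nat.card Q).Prime ∧ Nat.card Q ≠ p} with hB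
  have hcardsup : ∀ Q ∈ B, Nat.card (P ⊔ Q : Subgroup G) = Nat.card Q * Nat.card P := by
    rintro Q ⟨hQ, hQp⟩
    have : Q.Normal := Subgroup.normal_of_forall_card_eq fun R hR =>
      (huniq Q R hQ hQp hR.symm).symm
    apply Subgroup.card_sup_eq_mul_of_coprime
    rw [hP]
    exact (Nat.coprime_primes hp hQ).2 hQp.symm
  have hcov : ∀ Q ∈ B, P ⋖ P ⊔ Q := fun Q hQ =>
    Subgroup.covBy_of_card_eq_prime_mul hQ.1 le_sup_left (hcardsup Q hQ)
  have hinj : Set.InjOn (fun Q => P ⊔ Q) B := by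
    intro Q hQ R hR h
    have h1 := congrArg (fun L : Subgroup G => Nat.card L) h
    simp only [hcardsup Q hQ, hcardsup R hR] at h1
    exact huniq Q R hQ.1 hQ.2 (Nat.eq_of_mul_eq_mul_right Nat.card_pos h1)
  set S : Set (Subgroup G) := {K | P ≤ K ∧ Nat.card K = p ^ 2} with hS
  have hatoms : {Q : Subgroup G | (Nat.card Q).Prime} = {Q : Subgroup G | Nat.card Q = p} ∪ B := by
    ext Q
    simp only [hB, Set.mem_ofPred_eq, Set.mem_union]
    constructor
    · intro h
      by_cases hQ : Nat.card Q = p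
      · exact Or.inl hQ
      · exact Or.inr ⟨h, hQ⟩
    · rintro (h | h)
      · rwa [h]
      · exact h.1
  -- A cover of `P` either is a `p`-group, of order `p ^ 2`, or contains an atom of another order
  -- and is its join with `P`.
  have hcovers : {K | P ⋖ K} = S ∪ (fun Q => P ⊔ Q) '' B := by
    ext K
    simp only [Set.mem_ofPred_eq, Set.mem_union, Set.mem_image]
    constructor
    · intro hK
      by_cases hex : ∃ q, q.Prime ∧ q ∣ Nat.card K ∧ q ≠ p
      · obtain ⟨q, hq, hqd, hqp⟩ := hex
        obtain ⟨Q, hQK, hQ⟩ := Subgroup.exists_le_card_eq_prime hq hqd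
        refine Or.inr ⟨Q, ⟨hQ ▸ hq, hQ ▸ hqp⟩, hK.sup_eq_of_not_le hQK fun hQP => hqp ?_⟩
        have := Subgroup.card_dvd_of_le hQP
        rw [hQ, hP] at this
        exact (Nat.prime_dvd_prime_iff_eq hq hp).1 this
      · push Not at hex
        have hKp : IsPGroup p K := IsPGroup.of_card
          (Nat.eq_prime_pow_of_unique_prime_dvd Nat.card_pos.ne' fun {q} hq hqd => hex q hq hqd)
        refine Or.inl ⟨hK.le, ?_⟩
        rw [hKp.card_eq_of_covBy hp hK, hP, pow_two]
    · rintro (⟨hPK, hK⟩ | ⟨Q, hQ, rfl⟩)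
      · exact Subgroup.covBy_of_card_eq_prime_mul hp hPK (by rw [hK, hP, pow_two])
      · exact hcov Q hQ
  have hdisj1 : Disjoint {Q : Subgroup G | Nat.card Q = p} B :=
    Set.disjoint_left.2 fun Q hQ hQB => hQB.2 hQ
  have hdisj2 : Disjoint S ((fun Q => P ⊔ Q) '' B) := by
    refine Set.disjoint_left.2 ?_
    rintro _ hK ⟨Q, hQ, rfl⟩
    have h1 := hcardsup Q hQ
    rw [hK.2, hP, pow_two] at h1
    exact hQ.2 (Nat.eq_of_mul_eq_mul_right hp.pos h1).symm
  have hcount : S.ncard + 1 = {Q : Subgroup G | Nat.card Q = p}.ncard := by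
    have h1 := (hreg ⊥).trans (hreg P).symm
    rw [degree_bot_eq, subgroupGraph_degree_eq, ncard_covBy_isCyclic_isPGroup hp hPp hPne, hatoms,
      hcovers, Set.ncard_union_eq hdisj1, Set.ncard_union_eq hdisj2, hinj.ncard_image] at h1
    omega
  have hmod := ncard_subgroups_prime_modEq_one hp hdvd
  rw [← hcount] at hmod
  have hmod0 : S.ncard ≡ 0 [MOD p] := Nat.ModEq.add_right_cancel' 1 hmod
  have hsq : ¬ p ^ 2 ∣ Nat.card G := fun h => by
    have h1 := hmod0.symm.trans (ncard_prime_sq_overgroups_modEq_one hp h hP)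
    exact hp.one_lt.ne' (Nat.dvd_one.1 (Nat.modEq_zero_iff_dvd.1 h1.symm))
  refine ⟨hsq, ?_⟩
  have hSempty : S = ∅ := by
    refine Set.eq_empty_iff_forall_notMem.2 fun K hK => hsq ?_
    exact hK.2 ▸ Subgroup.card_subgroup_dvd_card K
  rw [← hcount, hSempty, Set.ncard_empty]

theorem subgroup_eq_of_card_eq_of_ncard_eq_one {G : Type*} [Group G] {p : ℕ}
    (h : {Q : Subgroup G | Nat.card Q = p}.ncard = 1) {Q R : Subgroup G} (hQ : Nat.card Q = p)
    (hR : Nat.card R = p) : Q = R := by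
  obtain ⟨P, hP⟩ := Set.ncard_eq_one.1 h
  have h1 : Q ∈ ({P} : Set (Subgroup G)) := hP ▸ hQ
  have h2 : R ∈ ({P} : Set (Subgroup G)) := hP ▸ hR
  exact h1.trans h2.symm

/-! ### From unique atoms to a cyclic group of square-free order. -/

theorem subgroup_eq_of_card_eq_prime {G : Type*} [Group G] [Finite G] {d : ℕ}
    (hreg : (subgroupGraph G).IsRegularOfDegree d) {Q R : Subgroup G} (hQ : (Nat.card Q).Prime)
    (h : Nat.card Q = Nat.card R) : Q = R := by
  rcases hQ.eq_two_or_odd' with h2 | hodd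
  · refine subgroup_eq_of_card_eq_of_ncard_eq_one
      (prime_sq_not_dvd_card_and_ncard_eq_one hreg hQ (Subgroup.card_subgroup_dvd_card Q) ?_).2
      rfl h.symm
    intro Q' R' hQ' hne h'
    rw [h2] at hne
    exact subgroup_eq_of_card_eq_odd_prime hreg hQ' (hQ'.odd_of_ne_two hne) rfl h'.symm
  · exact subgroup_eq_of_card_eq_odd_prime hreg hQ hodd rfl h.symm

theorem isCyclic_and_squarefree_of_isRegularOfDegree {G : Type*} [Group G] [Finite G] {d : ℕ}
    (hreg : (subgroupGraph G).IsRegularOfDegree d) : IsCyclic G ∧ Squarefree (Nat.card G) := by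
  have hsq : ∀ p, p.Prime → ¬ p ^ 2 ∣ Nat.card G := fun p hp h =>
    (prime_sq_not_dvd_card_and_ncard_eq_one hreg hp ((dvd_pow_self p two_ne_zero).trans h)
      fun _ _ hQ _ h => subgroup_eq_of_card_eq_prime hreg hQ h).1 h
  have hsquarefree : Squarefree (Nat.card G) :=
    Nat.squarefree_iff_prime_squarefree.2 fun p hp h => hsq p hp (by rwa [pow_two])
  refine ⟨?_, hsquarefree⟩
  have hZ : IsZGroup G := IsZGroup.of_squarefree hsquarefree
  have hnil : Group.IsNilpotent G := by
    have hsylow : Group.IsNilpotent G ↔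
        ∀ (p : ℕ) (_ : Fact p.Prime) (P : Sylow p G), (P : Subgroup G).Normal :=
      Group.isNilpotent_of_finite_tfae.out 0 3
    refine hsylow.2 fun p hp P => ?_
    obtain ⟨m, hm⟩ := IsPGroup.iff_card.1 P.isPGroup'
    -- A Sylow subgroup is trivial or of prime order, hence normal by uniqueness.
    rcases Nat.lt_or_ge m 2 with hlt | hge
    · interval_cases m
      · rw [pow_zero, Subgroup.card_eq_one] at hm
        rw [hm]
        infer_instance
      · rw [pow_one] at hm
        refine Subgroup.normal_of_forall_card_eq fun R hR => ?_
        exact (subgroup_eq_of_card_eq_prime hreg (by rw [hm]; exact hp.out) hR.symm).symm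
    · exact (hsq p hp.out ((pow_dvd_pow p hge).trans
        (hm ▸ Subgroup.card_subgroup_dvd_card (P : Subgroup G)))).elim
  infer_instance

/-! ### The converse: degrees in cyclic groups of square-free order. -/

theorem IsCyclic.exists_subgroup_card_eq {G : Type*} [Group G] [Finite G] [IsCyclic G] {m : ℕ}
    (h : m ∣ Nat.card G) : ∃ L : Subgroup G, Nat.card L = m := by
  obtain ⟨g, hg⟩ := IsCyclic.exists_ofOrder_eq_natCard (α := G)
  refine ⟨Subgroup.zpowers (g ^ (Nat.card G / m)), ?_⟩
  rw [Nat.card_zpowers, ← hg]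
  exact orderOf_pow_orderOf_div (hg ▸ Nat.card_pos.ne') (hg ▸ h)

theorem IsCyclic.subgroup_le_iff_card_dvd {G : Type*} [Group G] [Finite G] [IsCyclic G]
    {H K : Subgroup G} : H ≤ K ↔ Nat.card H ∣ Nat.card K := by
  refine ⟨Subgroup.card_dvd_of_le, fun h => ?_⟩
  obtain ⟨L, hL⟩ := IsCyclic.exists_subgroup_card_eq h
  have h1 : L.map K.subtype = H := Subgroup.eq_of_card_eq_of_isCyclic
    ((Subgroup.card_map_of_injective K.subtype_injective).trans hL)
  exact h1 ▸ Subgroup.map_subtype_le L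

theorem IsCyclic.covBy_iff {G : Type*} [Group G] [Finite G] [IsCyclic G] {H K : Subgroup G} :
    H ⋖ K ↔ ∃ q, q.Prime ∧ Nat.card K = q * Nat.card H := by
  constructor
  · intro h
    obtain ⟨a, ha⟩ := Subgroup.card_dvd_of_le h.le
    have ha1 : a ≠ 1 := by
      rintro rfl
      exact h.lt.ne (Subgroup.eq_of_card_eq_of_isCyclic (by rw [ha, mul_one]))
    obtain ⟨q, hq, b, rfl⟩ := Nat.exists_prime_and_dvd ha1
    have hdvd : q * Nat.card H ∣ Nat.card K := ⟨b, by rw [ha]; ring⟩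
    obtain ⟨L, hL⟩ := IsCyclic.exists_subgroup_card_eq
      (hdvd.trans (Subgroup.card_subgroup_dvd_card K))
    have hHL : H ⋖ L := Subgroup.covBy_of_card_eq_prime_mul hq
      (IsCyclic.subgroup_le_iff_card_dvd.2 (hL ▸ dvd_mul_left _ _)) hL
    have hLK : L = K := (h.eq_or_eq hHL.le
      (IsCyclic.subgroup_le_iff_card_dvd.2 (hL ▸ hdvd))).resolve_left hHL.lt.ne'
    exact ⟨q, hq, hLK ▸ hL⟩
  · rintro ⟨q, hq, h⟩
    exact Subgroup.covBy_of_card_eq_prime_mul hq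
      (IsCyclic.subgroup_le_iff_card_dvd.2 (h ▸ dvd_mul_left _ _)) h

/-- The index of a cover is a prime that determines it. Primes dividing `|H|` give the lower covers
and the others the upper ones; square-freeness keeps a prime from doing both. -/
theorem subgroupGraph_degree_of_isCyclic_of_squarefree {G : Type*} [Group G] [Finite G]
    [IsCyclic G] (hsq : Squarefree (Nat.card G)) (H : Subgroup G) :
    (subgroupGraph G).degree H = (Nat.card G).primeFactors.card := by
  have hn : Nat.card G ≠ 0 := Nat.card_pos.ne'
  have hpos : 0 < Nat.card H := Nat.card_pos
  have hHG := Subgroup.card_subgroup_dvd_card H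
  have hup : {K | H ⋖ K}.ncard =
      ((Nat.card G).primeFactors.filter fun p => ¬ p ∣ Nat.card H).card := by
    rw [← Set.ncard_coe_finset]
    refine Set.ncard_congr (fun K _ => Nat.card K / Nat.card H) ?_ ?_ ?_
    · intro K hK
      obtain ⟨q, hq, hKq⟩ := IsCyclic.covBy_iff.1 hK
      have hKG := Subgroup.card_subgroup_dvd_card K
      simp only [hKq, Nat.mul_div_cancel _ hpos, Finset.coe_filter, Set.mem_ofPred_eq,
        Nat.mem_primeFactors]
      refine ⟨⟨hq, (hKq ▸ dvd_mul_right _ _ : q ∣ Nat.card K).trans hKG, hn⟩, fun hqH => ?_⟩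
      have : q * q ∣ Nat.card G := (mul_dvd_mul_left q hqH).trans (hKq ▸ hKG)
      exact hq.one_lt.ne' (Nat.isUnit_iff.1 (hsq q this))
    · intro K L hK hL h
      obtain ⟨q, hq, hKq⟩ := IsCyclic.covBy_iff.1 hK
      obtain ⟨r, hr, hLr⟩ := IsCyclic.covBy_iff.1 hL
      simp only [hKq, hLr, Nat.mul_div_cancel _ hpos] at h
      exact Subgroup.eq_of_card_eq_of_isCyclic (by rw [hKq, hLr, h])
    · intro p hp
      simp only [Finset.coe_filter, Set.mem_ofPred_eq, Nat.mem_primeFactors] at hp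
      obtain ⟨K, hK⟩ := IsCyclic.exists_subgroup_card_eq (G := G) (m := p * Nat.card H)
        (Nat.Coprime.mul_dvd_of_dvd_of_dvd ((hp.1.1.coprime_iff_not_dvd).2 hp.2) hp.1.2.1 hHG)
      exact ⟨K, IsCyclic.covBy_iff.2 ⟨p, hp.1.1, hK⟩, by rw [hK, Nat.mul_div_cancel _ hpos]⟩
  have hdown : {K | K ⋖ H}.ncard =
      ((Nat.card G).primeFactors.filter fun p => p ∣ Nat.card H).card := by
    rw [← Set.ncard_coe_finset]
    refine Set.ncard_congr (fun K _ => Nat.card H / Nat.card K) ?_ ?_ ?_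
    · intro K hK
      obtain ⟨q, hq, hKq⟩ := IsCyclic.covBy_iff.1 hK
      have hqH : q ∣ Nat.card H := hKq ▸ dvd_mul_right _ _
      simp only [Finset.coe_filter, Set.mem_ofPred_eq, Nat.mem_primeFactors]
      rw [hKq, Nat.mul_div_cancel _ Nat.card_pos, ← hKq]
      exact ⟨⟨hq, hqH.trans hHG, hn⟩, hqH⟩
    · intro K L hK hL h
      obtain ⟨q, hq, hKq⟩ := IsCyclic.covBy_iff.1 hK
      obtain ⟨r, hr, hLr⟩ := IsCyclic.covBy_iff.1 hL
      have h1 : Nat.card H / Nat.card K = q := by rw [hKq, Nat.mul_div_cancel _ Nat.card_pos]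
      have h2 : Nat.card H / Nat.card L = r := by rw [hLr, Nat.mul_div_cancel _ Nat.card_pos]
      obtain rfl : q = r := by rw [← h1, ← h2]; exact h
      exact Subgroup.eq_of_card_eq_of_isCyclic
        (Nat.eq_of_mul_eq_mul_left hq.pos (hKq.symm.trans hLr))
    · intro p hp
      simp only [Finset.coe_filter, Set.mem_ofPred_eq, Nat.mem_primeFactors] at hp
      obtain ⟨a, ha⟩ := hp.2
      obtain ⟨K, hK⟩ := IsCyclic.exists_subgroup_card_eq (G := G) (m := a)
        ((ha ▸ dvd_mul_left _ _ : a ∣ Nat.card H).trans hHG)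
      refine ⟨K, IsCyclic.covBy_iff.2 ⟨p, hp.1.1, by rw [ha, hK]⟩, ?_⟩
      rw [ha, ← hK, Nat.mul_div_cancel _ Nat.card_pos]
  rw [subgroupGraph_degree_eq, hup, hdown, add_comm,
    Finset.card_filter_add_card_filter_not]

theorem mainTheorem1 (G : Type*) [Group G] [Finite G] :
    ((∃ d : ℕ, (subgroupGraph G).IsRegularOfDegree d) ↔
      (IsCyclic G ∧ Squarefree (Nat.card G))) ∧
    (IsCyclic G → Squarefree (Nat.card G) →
      ∀ H : Subgroup G, (subgroupGraph G).degree H = (Nat.card G).primeFactors.card) := by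
  refine ⟨⟨?_, ?_⟩, ?_⟩
  · rintro ⟨d, hd⟩
    exact isCyclic_and_squarefree_of_isRegularOfDegree hd
  · rintro ⟨hcyc, hsq⟩
    exact ⟨_, subgroupGraph_degree_of_isCyclic_of_squarefree hsq⟩
  · intro hcyc hsq
    exact subgroupGraph_degree_of_isCyclic_of_squarefree hsq
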